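/- For a discrete group $G$ let $l^2(G)$ be the Hilbert space of square-summable functions $G\to\mathbb{C}$. A matrix $\Delta\in M(d\times d,\mathbb{Z}G)$ acts as a bounded operator on $l^2(G)^d$ by left multiplication, where $g\in G$ acts on $l^2(G)$ by left translation. For a bounded operator $T=(T_{ij})$ on $l^2(G)^d$ put $\operatorname{tr}_G(T)=\sum_{i=1}^d (T_{ii}\delta_1,\delta_1)_{l^2(G)}$, where $\delta_1\in l^2(G)$ is the characteristic function of the unit element. If $\Delta$ is positive and self-adjoint as an operator, its spectral density function is $F_\Delta(\lambda)=\operatorname{tr}_G\chi_{[0,\lambda]}(\Delta)$, and $\Delta$ is said to be of $G$-determinant class if the Lebesgue--Stieltjes integral satisfies $$\int_{0^+}^1\ln(\lambda)\,dF_\Delta(\lambda)>-\infty .$$ The group $G$ is said to be of determinant class if for every $d$ each $\Delta\in M(d\times d,\mathbb{Z}G)$ which is positive and self-adjoint is of $G$-determinant class. **Proposition.** Suppose $1\to F\to\pi\to Q\to 1$ is an extension of groups with $|F|<\infty$, and $\pi$ is of determinant class. Then $Q$ is also of determinant class. -/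

import Mathlib

open scoped ENNReal InnerProductSpace

noncomputable section

namespace L2Det

/-- The Hilbert space `l²(G)` of square-summable complex functions on the discrete group `G`. -/
abbrev ell2 (G : Type*) : Type _ := lp (fun _ : G => ℂ) 2

/-- The Hilbert space `l²(G)^d`. -/
abbrev ell2Pow (G : Type*) (d : ℕ) : Type _ := PiLp 2 (fun _ : Fin d => ell2 G)

section Translation

variable {G : Type*} [Group G]

theorem memℓp_translate (g : G) (f : ell2 G) :
    Memℓp (fun h : G => f (g⁻¹ * h)) 2 := by
  have hp : 0 < (2 : ℝ≥0∞).toReal := by norm_num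
  rw [memℓp_gen_iff hp]
  exact ((memℓp_gen_iff hp).1 (lp.memℓp f)).comp_injective (mul_right_injective g⁻¹)

/-- Left translation by `g` on `l²(G)`: `(g • f) h = f (g⁻¹ * h)`, so that `g • δ_h = δ_{gh}`. -/
def translate (g : G) : ell2 G →ₗᵢ[ℂ] ell2 G where
  toFun f := ⟨fun h => f (g⁻¹ * h), memℓp_translate g f⟩
  map_add' _ _ := rfl
  map_smul' _ _ := rfl
  norm_map' f := by
    have hp : 0 < (2 : ℝ≥0∞).toReal := by norm_num
    rw [lp.norm_eq_tsum_rpow hp, lp.norm_eq_tsum_rpow hp]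
    congr 1
    exact (Equiv.mulLeft g⁻¹).tsum_eq (fun h => ‖f h‖ ^ (2 : ℝ≥0∞).toReal)

theorem translate_apply (g : G) (f : ell2 G) (h : G) : translate g f h = f (g⁻¹ * h) := rfl

variable (G) in
/-- The left regular representation of `G` on `l²(G)` by bounded operators. -/
def leftRegular : G →* (ell2 G →L[ℂ] ell2 G) where
  toFun g := (translate g).toContinuousLinearMap
  map_one' := by
    ext f h
    change f (1⁻¹ * h) = f h
    simp
  map_mul' a b := by
    ext f h
    change f ((a * b)⁻¹ * h) = f (b⁻¹ * (a⁻¹ * h))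
    rw [mul_inv_rev, mul_assoc]

variable (G) in
/-- The integral group ring `ℤG` acting on `l²(G)` by multiplication from the left. -/
def ringAction : MonoidAlgebra ℤ G →ₐ[ℤ] (ell2 G →L[ℂ] ell2 G) :=
  MonoidAlgebra.lift ℤ (ell2 G →L[ℂ] ell2 G) G (leftRegular G)

/-- The bounded operator on `l²(G)^d` given by a matrix over `ℤG` acting from the left:
`(A v)_i = ∑ j, A_ij v_j`. -/
def matrixOp {d : ℕ} (A : Matrix (Fin d) (Fin d) (MonoidAlgebra ℤ G)) :
    ell2Pow G d →L[ℂ] ell2Pow G d :=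
  (PiLp.continuousLinearEquiv 2 ℂ (fun _ : Fin d => ell2 G)).symm.toContinuousLinearMap ∘L
    ContinuousLinearMap.pi (fun i =>
      ∑ j, ringAction G (A i j) ∘L PiLp.proj 2 (fun _ : Fin d => ell2 G) j)

theorem matrixOp_apply {d : ℕ} (A : Matrix (Fin d) (Fin d) (MonoidAlgebra ℤ G))
    (v : ell2Pow G d) (i : Fin d) :
    matrixOp A v i = ∑ j, ringAction G (A i j) (v j) := by
  simp [matrixOp]

open Classical in
/-- The vector of `l²(G)^d` whose `i`-th coordinate is the unit element `1 = δ_1` of `l²(G)` and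
whose other coordinates vanish. -/
def unitVec {d : ℕ} (i : Fin d) : ell2Pow G d :=
  WithLp.toLp 2 (Pi.single i (lp.single 2 (1 : G) (1 : ℂ)))

/-- The trace `tr_G T = ∑ i, (T_ii 1, 1)` on operators on `l²(G)^d`, where the scalar product of
`l²(G)` is linear in its first argument. -/
def trace {d : ℕ} (T : ell2Pow G d →L[ℂ] ell2Pow G d) : ℂ :=
  ∑ i : Fin d, ⟪(unitVec i : ell2Pow G d), T (unitVec i)⟫_ℂ

end Translation

section Spectral

variable {H : Type*} [NormedAddCommGroup H] [InnerProductSpace ℂ H] [CompleteSpace H]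

/-- The kernel of the positive part `(T - t)⁺`. -/
def spectralSubspace (T : H →L[ℂ] H) (t : ℝ) : Submodule ℂ H :=
  (cfc (fun s : ℝ => max (s - t) 0) T).ker

instance (T : H →L[ℂ] H) (t : ℝ) : CompleteSpace (spectralSubspace T t) :=
  (ContinuousLinearMap.isClosed_ker (cfc (fun s : ℝ => max (s - t) 0) T)).completeSpace_coe

/-- The spectral projection `χ_{(-∞,t]}(T)` of a bounded self-adjoint operator `T`: the orthogonal
projection onto the kernel of `(T - t)⁺`. If `T` is positive, this is `χ_{[0,t]}(T)` for `t ≥ 0`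
and zero for `t < 0`. -/
def spectralProjection (T : H →L[ℂ] H) (t : ℝ) : H →L[ℂ] H :=
  (spectralSubspace T t).starProjection

theorem spectralSubspace_mono (T : H →L[ℂ] H) : Monotone (spectralSubspace T) := by
  intro s t hst x hx
  have hx' : cfc (fun r : ℝ => max (r - s) 0) T x = 0 := hx
  change cfc (fun r : ℝ => max (r - t) 0) T x = 0
  have hB : (cfc (fun r : ℝ => max (r - t) 0) T).IsPositive :=
    (ContinuousLinearMap.nonneg_iff_isPositive _).1 (cfc_nonneg fun _ _ => le_max_right _ _)
  have hle : cfc (fun r : ℝ => max (r - t) 0 * max (r - t) 0) T ≤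
      cfc (fun r : ℝ => max (r - s) 0 * max (r - s) 0) T := by
    refine cfc_mono (fun r _ => ?_)
    have h : max (r - t) 0 ≤ max (r - s) 0 := max_le_max (by linarith) le_rfl
    exact mul_self_le_mul_self (le_max_right _ _) h
  rw [cfc_mul (fun r : ℝ => max (r - t) 0) (fun r : ℝ => max (r - t) 0) T,
    cfc_mul (fun r : ℝ => max (r - s) 0) (fun r : ℝ => max (r - s) 0) T] at hle
  have h1 := ((ContinuousLinearMap.le_def _ _).1 hle).re_inner_nonneg_left x
  simp only [sub_apply, mul_apply_eq_comp, hx', map_zero,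
    zero_sub, inner_neg_left, map_neg] at h1
  rw [hB.inner_left_eq_inner_right, inner_self_eq_norm_sq_to_K] at h1
  norm_cast at h1
  have h2 : ‖cfc (fun r : ℝ => max (r - t) 0) T x‖ = 0 := by
    nlinarith [norm_nonneg (cfc (fun r : ℝ => max (r - t) 0) T x)]
  exact norm_eq_zero.1 h2

end Spectral

section Determinant

variable {G : Type*} [Group G] {d : ℕ}

/-- The spectral density function `F_T(t) = tr_G χ_{[0,t]}(T)`. -/
def spectralDensity (T : ell2Pow G d →L[ℂ] ell2Pow G d) (t : ℝ) : ℝ :=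
  (trace (spectralProjection T t)).re

theorem spectralDensity_mono (T : ell2Pow G d →L[ℂ] ell2Pow G d) :
    Monotone (spectralDensity T) := by
  intro s t hst
  have h : spectralProjection T s ≤ spectralProjection T t :=
    Submodule.starProjection_le_starProjection_iff.2 (spectralSubspace_mono T hst)
  simp only [spectralDensity, trace, Complex.re_sum]
  refine Finset.sum_le_sum fun i _ => ?_
  have h1 := ((ContinuousLinearMap.le_def _ _).1 h).re_inner_nonneg_right (unitVec i)
  rw [sub_apply, inner_sub_right, map_sub, sub_nonneg] at h1
  exact h1

/-- The Lebesgue--Stieltjes measure `dF_T` on the real line. -/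
def spectralMeasure (T : ell2Pow G d →L[ℂ] ell2Pow G d) : MeasureTheory.Measure ℝ :=
  (spectralDensity_mono T).stieltjesFunction.measure

/-- An operator `T` is of determinant class if `∫_{0⁺}^1 ln t dF_T(t) > -∞`. As `ln ≤ 0` on
`(0,1]`, this says that the integral of the nonnegative function `-ln` is finite. -/
def IsDetClassOp (T : ell2Pow G d →L[ℂ] ell2Pow G d) : Prop :=
  ∫⁻ t in Set.Ioc (0 : ℝ) 1, ENNReal.ofReal (-Real.log t) ∂(spectralMeasure T) < ∞

variable (G) in
/-- The discrete group `G` is of determinant class: every square matrix over `ℤG` that is positive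
and self-adjoint (as an operator on `l²(G)^d`) is of determinant class. -/
def IsDetClass : Prop :=
  ∀ (d : ℕ) (A : Matrix (Fin d) (Fin d) (MonoidAlgebra ℤ G)),
    (matrixOp A).IsPositive → IsDetClassOp (matrixOp A)

end Determinant

end L2Det

end

/-! Let `U : l²(Q)^d → l²(π)^d` be the isometry `φ ↦ |F|^{-1/2} φ ∘ p` in each coordinate; its range
is the space of `F`-invariant vectors. The norm element `N = ∑ a ∈ F, a` acts as `|F| U U*`, so for
any entrywise lift `Ã` of `A` to `ℤπ` the matrix `B = Ã N` acts as `U (|F| A) U*`, which is positive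
because `A` is (`exists_matrixOp_eq_conjIsometry`). The complement of the range of `U` only enlarges
the kernel, and conjugation by `U` divides the trace by `|F|`. Hence `F_B(t) = const + |F|⁻¹ F_A(t /
|F|)` for `t ≥ 0` (`spectralDensity_conjIsometry`, `spectralProjection_smul`). The constant has no
mass on `(0, ∞)`, and rescaling changes `-ln` by `ln |F|` on a set of finite measure
(`lintegral_neg_log_lt_top_of_eq_affine`). -/

noncomputable section

namespace L2Det

/-! ### Spectral projections under conjugation by an isometry and under scaling. -/

section Isometry

variable {H K : Type*} [NormedAddCommGroup H] [InnerProductSpace ℂ H] [CompleteSpace H]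
  [NormedAddCommGroup K] [InnerProductSpace ℂ K] [CompleteSpace K]

theorem adjoint_isometry_apply (U : H →ₗᵢ[ℂ] K) (x : H) :
    U.toContinuousLinearMap.adjoint (U x) = x :=
  ext_inner_right ℂ fun y => by
    rw [ContinuousLinearMap.adjoint_inner_left]
    exact U.inner_map_map x y

/-- Conjugation `T ↦ U T U*` by an isometry `U`, as a homomorphism of non-unital star algebras. -/
def conjIsometry (U : H →ₗᵢ[ℂ] K) : (H →L[ℂ] H) →⋆ₙₐ[ℂ] (K →L[ℂ] K) where
  toFun T := U.toContinuousLinearMap ∘L T ∘L U.toContinuousLinearMap.adjoint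
  map_smul' c T := by ext x; simp
  map_zero' := by ext x; simp
  map_add' S T := by ext x; simp
  map_mul' S T := by
    ext x
    simp [adjoint_isometry_apply]
  map_star' T := by
    simp [ContinuousLinearMap.star_eq_adjoint, ContinuousLinearMap.adjoint_comp,
      ContinuousLinearMap.comp_assoc]

theorem conjIsometry_apply (U : H →ₗᵢ[ℂ] K) (T : H →L[ℂ] H) (x : K) :
    conjIsometry U T x = U (T (U.toContinuousLinearMap.adjoint x)) := rfl

theorem continuous_conjIsometry (U : H →ₗᵢ[ℂ] K) : Continuous (conjIsometry U) := by
  change Continuous fun T : H →L[ℂ] H =>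
    U.toContinuousLinearMap ∘L T ∘L U.toContinuousLinearMap.adjoint
  fun_prop

/-- Conjugation is not unital, so only functions vanishing at `0` commute with it; `s ↦ max (s - t)
0` is one exactly because `t ≥ 0`. -/
theorem mem_spectralSubspace_conjIsometry (U : H →ₗᵢ[ℂ] K) {T : H →L[ℂ] H}
    (hT : IsSelfAdjoint T) {t : ℝ} (ht : 0 ≤ t) (x : K) :
    x ∈ spectralSubspace (conjIsometry U T) t ↔
      U.toContinuousLinearMap.adjoint x ∈ spectralSubspace T t := by
  have h0 : (fun s : ℝ => max (s - t) 0) 0 = 0 := by simp [ht]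
  have hc : Continuous fun s : ℝ => max (s - t) 0 := by fun_prop
  have hφT : IsSelfAdjoint (conjIsometry U T) := hT.map (conjIsometry U)
  have h := NonUnitalStarAlgHom.map_cfcₙ (R := ℝ) (S := ℂ) (conjIsometry U)
    (fun s : ℝ => max (s - t) 0) T hc.continuousOn h0 (continuous_conjIsometry U) hT hφT
  rw [cfcₙ_eq_cfc hc.continuousOn h0, cfcₙ_eq_cfc hc.continuousOn h0] at h
  change cfc (fun s : ℝ => max (s - t) 0) (conjIsometry U T) x = 0 ↔
    cfc (fun s : ℝ => max (s - t) 0) T _ = 0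
  rw [← h, conjIsometry_apply, map_eq_zero_iff U U.injective]

/-- The summand `1 - U U*` is there because `U T U*` vanishes on the complement of the range of `U`,
and `0 ≤ t`. -/
theorem spectralProjection_conjIsometry (U : H →ₗᵢ[ℂ] K) {T : H →L[ℂ] H}
    (hT : IsSelfAdjoint T) {t : ℝ} (ht : 0 ≤ t) :
    spectralProjection (conjIsometry U T) t =
      1 - conjIsometry U 1 + conjIsometry U (spectralProjection T t) := by
  ext x
  set y := U.toContinuousLinearMap.adjoint x with hy
  have hx : (1 - conjIsometry U 1 + conjIsometry U (spectralProjection T t)) x =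
      x - U y + U (spectralProjection T t y) := by
    simp [conjIsometry_apply, hy]
  rw [hx]
  refine Submodule.eq_starProjection_of_mem_of_inner_eq_zero ?_ fun w hw => ?_
  · rw [mem_spectralSubspace_conjIsometry U hT ht, map_add, map_sub, adjoint_isometry_apply,
      adjoint_isometry_apply, ← hy, sub_self, zero_add]
    exact Submodule.starProjection_apply_mem _ _
  · rw [mem_spectralSubspace_conjIsometry U hT ht] at hw
    have h : x - (x - U y + U (spectralProjection T t y)) = U (y - spectralProjection T t y) := by
      rw [map_sub]; abel
    rw [h]
    exact (ContinuousLinearMap.adjoint_inner_right U.toContinuousLinearMap _ _).symm.trans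
      (Submodule.starProjection_inner_eq_zero y _ hw)

theorem spectralSubspace_smul {T : H →L[ℂ] H} (hT : IsSelfAdjoint T) {c : ℝ} (hc : 0 < c) (t : ℝ) :
    spectralSubspace (c • T) (c * t) = spectralSubspace T t := by
  have h : cfc (fun s : ℝ => max (s - c * t) 0) (c • T) =
      c • cfc (fun s : ℝ => max (s - t) 0) T := by
    rw [← cfc_comp_smul c (fun s : ℝ => max (s - c * t) 0) T, ← cfc_smul c _ T]
    congr 1
    ext s
    rw [smul_eq_mul, smul_eq_mul, mul_max_of_nonneg _ _ hc.le, mul_sub, mul_zero]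
  ext x
  change cfc (fun s : ℝ => max (s - c * t) 0) (c • T) x = 0 ↔
    cfc (fun s : ℝ => max (s - t) 0) T x = 0
  rw [h, _root_.smul_apply, smul_eq_zero_iff_right hc.ne']

theorem spectralProjection_smul {T : H →L[ℂ] H} (hT : IsSelfAdjoint T) {c : ℝ} (hc : 0 < c)
    (t : ℝ) : spectralProjection ((c : ℂ) • T) (c * t) = spectralProjection T t := by
  rw [Complex.coe_smul]
  unfold spectralProjection
  simp only [spectralSubspace_smul hT hc t]

end Isometry

/-! ### The embedding of `l²(Q)` into `l²(π)` and the norm element of `F`. -/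

section Pullback

variable {F π Q : Type*} [Group F] [Group π] [Group Q] (S : GroupExtension F π Q)

theorem rightHom_inl (S : GroupExtension F π Q) (a : F) : S.rightHom (S.inl a) = 1 :=
  S.rightHom.mem_ker.1 (S.range_inl_eq_ker_rightHom ▸ ⟨a, rfl⟩)

/-- A set-theoretic section of the extension identifies `π` with `Q × F`. -/
def prodEquivOfExtension : Q × F ≃ π :=
  Equiv.ofBijective (fun x => S.inl x.2 * Function.surjInv S.rightHom_surjective x.1) <| by
    have hs := Function.surjInv_eq S.rightHom_surjective
    constructor
    · rintro ⟨q, a⟩ ⟨q', a'⟩ h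
      have hq : q = q' := by
        simpa [rightHom_inl, hs] using congrArg S.rightHom h
      subst hq
      simpa [S.inl_injective.eq_iff] using h
    · intro g
      have hg : g * (Function.surjInv S.rightHom_surjective (S.rightHom g))⁻¹ ∈ S.inl.range := by
        rw [S.range_inl_eq_ker_rightHom, MonoidHom.mem_ker, map_mul, map_inv, hs, mul_inv_cancel]
      obtain ⟨a, ha⟩ := hg
      exact ⟨(S.rightHom g, a), by simp [ha]⟩

theorem rightHom_prodEquivOfExtension (x : Q × F) :
    S.rightHom (prodEquivOfExtension S x) = x.1 := by
  change S.rightHom (S.inl x.2 * Function.surjInv S.rightHom_surjective x.1) = x.1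
  rw [map_mul, rightHom_inl, one_mul, Function.surjInv_eq S.rightHom_surjective]

variable [Finite F]

/-- Every fibre of `π → Q` has `|F|` elements. -/
theorem hasSum_comp_rightHom {f : Q → ℝ} {s : ℝ} (hf : HasSum f s) (hf0 : 0 ≤ f) :
    HasSum (fun g => f (S.rightHom g)) (s * Nat.card F) := by
  have := Fintype.ofFinite F
  have h1 : HasSum (fun _ : F => (1 : ℝ)) (Nat.card F) := by
    simpa using hasSum_fintype (fun _ : F => (1 : ℝ))
  have h := hf.mul h1 (hf.summable.mul_of_nonneg h1.summable hf0 fun _ => zero_le_one)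
  rw [← (prodEquivOfExtension S).hasSum_iff]
  simpa [Function.comp_def, rightHom_prodEquivOfExtension] using h

theorem memℓp_comp_rightHom (φ : ell2 Q) : Memℓp (fun g : π => φ (S.rightHom g)) 2 := by
  have hp : 0 < (2 : ℝ≥0∞).toReal := by norm_num
  rw [memℓp_gen_iff hp]
  exact (hasSum_comp_rightHom S ((memℓp_gen_iff hp).1 (lp.memℓp φ)).hasSum
    fun _ => by positivity).summable

theorem sqrt_card_ne_zero {F : Type*} [Nonempty F] [Finite F] : ((√(Nat.card F) : ℝ) : ℂ) ≠ 0 := by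
  have : (0 : ℝ) < Nat.card F := by exact_mod_cast Nat.card_pos
  exact_mod_cast (Real.sqrt_pos.2 this).ne'

/-- The isometric embedding `φ ↦ |F|^{-1/2} φ ∘ p` of `l²(Q)` into `l²(π)`. -/
def pullback : ell2 Q →ₗᵢ[ℂ] ell2 π where
  toFun φ := ((√(Nat.card F) : ℝ) : ℂ)⁻¹ • ⟨fun g => φ (S.rightHom g), memℓp_comp_rightHom S φ⟩
  map_add' φ ψ := by rw [← smul_add]; rfl
  map_smul' c φ := by rw [RingHom.id_apply, smul_comm]; rfl
  norm_map' φ := by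
    have hp : 0 < (2 : ℝ≥0∞).toReal := by norm_num
    have hn : (0 : ℝ) < Nat.card F := by exact_mod_cast Nat.card_pos
    have h := (hasSum_comp_rightHom S (lp.hasSum_norm hp φ) fun _ => by positivity).unique
      (lp.hasSum_norm hp (⟨fun g => φ (S.rightHom g), memℓp_comp_rightHom S φ⟩ : ell2 π))
    simp only [ENNReal.toReal_ofNat, Real.rpow_ofNat] at h
    rw [LinearMap.coe_mk, AddHom.coe_mk, norm_smul, norm_inv, Complex.norm_real, Real.norm_eq_abs,
      abs_of_nonneg (Real.sqrt_nonneg _), inv_mul_eq_iff_eq_mul₀ (Real.sqrt_pos.2 hn).ne',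
      ← sq_eq_sq₀ (norm_nonneg _) (by positivity), mul_pow, Real.sq_sqrt hn.le, ← h, mul_comm]

theorem pullback_apply (φ : ell2 Q) (g : π) :
    pullback S φ g = ((√(Nat.card F) : ℝ) : ℂ)⁻¹ * φ (S.rightHom g) := rfl

theorem translate_pullback (g : π) (φ : ell2 Q) :
    translate g (pullback S φ) = pullback S (translate (S.rightHom g) φ) := by
  ext h
  simp [translate_apply, pullback_apply]

theorem ringAction_pullback (x : MonoidAlgebra ℤ π) (φ : ell2 Q) :
    ringAction π x (pullback S φ) =
      pullback S (ringAction Q (MonoidAlgebra.mapDomain S.rightHom x) φ) := by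
  induction x using MonoidAlgebra.induction_linear with
  | zero => simp
  | add x y hx hy => simp [MonoidAlgebra.mapDomain_add, hx, hy]
  | single g r =>
    have h := translate_pullback S g φ
    simp [ringAction, leftRegular, h]

theorem exists_pullback_eq (f : ell2 π) (hf : ∀ a g, f (S.inl a * g) = f g) :
    ∃ φ, pullback S φ = f := by
  have hp : 0 < (2 : ℝ≥0∞).toReal := by norm_num
  have hs := Function.surjInv_eq S.rightHom_surjective
  have hm : Memℓp (fun q => f (Function.surjInv S.rightHom_surjective q)) 2 := by
    rw [memℓp_gen_iff hp]
    exact ((memℓp_gen_iff hp).1 (lp.memℓp f)).comp_injective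
      (Function.injective_surjInv S.rightHom_surjective)
  refine ⟨((√(Nat.card F) : ℝ) : ℂ) • ⟨_, hm⟩, ?_⟩
  ext g
  obtain ⟨⟨q, a⟩, rfl⟩ := (prodEquivOfExtension S).surjective g
  rw [map_smul, lp.coeFn_smul, Pi.smul_apply, pullback_apply, rightHom_prodEquivOfExtension,
    smul_eq_mul, mul_inv_cancel_left₀ sqrt_card_ne_zero]
  exact (hf a _).symm

variable (F) in
/-- The norm element `∑ a ∈ F, a` of the group ring. -/
def normElement : MonoidAlgebra ℤ π :=
  ∑ᶠ a : F, MonoidAlgebra.single (S.inl a) 1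

omit [Finite F] in
theorem ringAction_normElement [Fintype F] (f : ell2 π) :
    ringAction π (normElement F S) f = ∑ a : F, translate (S.inl a) f := by
  rw [normElement, finsum_eq_sum_of_fintype]
  simp [ringAction, leftRegular]

/-- Averaging over `F` is the orthogonal projection onto the `F`-invariant functions, which are the
range of `pullback S`. -/
theorem ringAction_normElement_eq_smul (f : ell2 π) :
    ringAction π (normElement F S) f =
      (Nat.card F : ℂ) • pullback S ((pullback S).toContinuousLinearMap.adjoint f) := by
  have := Fintype.ofFinite F
  set V := (pullback S).toContinuousLinearMap.adjoint
  obtain ⟨ψ, hψ⟩ := exists_pullback_eq S (ringAction π (normElement F S) f) fun b g => by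
    simp only [ringAction_normElement, lp.coeFn_sum, Finset.sum_apply, translate_apply]
    refine Fintype.sum_equiv (Equiv.mulLeft b⁻¹) _ _ fun a => ?_
    simp [mul_assoc]
  rw [← hψ, ← map_smul]
  congr 1
  refine ext_inner_right ℂ fun φ => ?_
  rw [← (pullback S).inner_map_map, hψ, ringAction_normElement, sum_inner, inner_smul_left,
    ContinuousLinearMap.adjoint_inner_left]
  -- Translation by `a ∈ F` is isometric and fixes every pullback.
  have h (a : F) : ⟪translate (S.inl a) f, pullback S φ⟫_ℂ = ⟪f, pullback S φ⟫_ℂ := by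
    rw [← (translate (S.inl a)).inner_map_map f, translate_pullback, rightHom_inl]
    congr 2
    ext q
    simp [translate_apply]
  simp [h]

-- Source of the factor `|F|⁻¹` in the trace: `|F|^{-1/2}` enters once from each side of the scalar
-- product.
open Classical in
theorem adjoint_pullback_single_one :
    (pullback S).toContinuousLinearMap.adjoint (lp.single 2 (1 : π) (1 : ℂ)) =
      ((√(Nat.card F) : ℝ) : ℂ)⁻¹ • lp.single 2 (1 : Q) (1 : ℂ) := by
  refine ext_inner_right ℂ fun φ => ?_
  rw [ContinuousLinearMap.adjoint_inner_left, inner_smul_left, lp.inner_single_left,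
    lp.inner_single_left]
  simp [pullback_apply, mul_comm]

variable (d : ℕ)

/-- The isometric embedding of `l²(Q)^d` into `l²(π)^d` which is `pullback` in each coordinate. -/
def pullbackPow : ell2Pow Q d →ₗᵢ[ℂ] ell2Pow π d where
  toFun v := WithLp.toLp 2 fun i => pullback S (v i)
  map_add' v w := by ext1 i; simp
  map_smul' c v := by ext1 i; simp
  norm_map' v := by simp [PiLp.norm_eq_of_L2]

theorem pullbackPow_apply (v : ell2Pow Q d) (i : Fin d) :
    pullbackPow S d v i = pullback S (v i) := rfl

theorem adjoint_pullbackPow_apply (v : ell2Pow π d) (i : Fin d) :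
    (pullbackPow S d).toContinuousLinearMap.adjoint v i =
      (pullback S).toContinuousLinearMap.adjoint (v i) := by
  suffices h : (pullbackPow S d).toContinuousLinearMap.adjoint v =
      WithLp.toLp 2 fun i => (pullback S).toContinuousLinearMap.adjoint (v i) by rw [h]
  refine ext_inner_right ℂ fun w => ?_
  rw [ContinuousLinearMap.adjoint_inner_left, PiLp.inner_apply, PiLp.inner_apply]
  refine Finset.sum_congr rfl fun i _ => ?_
  exact (ContinuousLinearMap.adjoint_inner_left (pullback S).toContinuousLinearMap
    (w i) (v i)).symm

theorem adjoint_pullbackPow_unitVec (i : Fin d) :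
    (pullbackPow S d).toContinuousLinearMap.adjoint (unitVec i) =
      ((√(Nat.card F) : ℝ) : ℂ)⁻¹ • unitVec i := by
  classical
  ext1 j
  rw [adjoint_pullbackPow_apply, PiLp.smul_apply]
  by_cases h : j = i
  · subst h
    simpa [unitVec] using adjoint_pullback_single_one S
  · simp [unitVec, h]

end Pullback

/-! ### Affine change of variable in Stieltjes measures. -/

section Stieltjes

open MeasureTheory Set Filter Topology

/-- Stieltjes measures see only right limits. These involve only points above `s`, so the relation
on `[0, ∞)` suffices. -/
theorem rightLim_eq_of_eq_affine {f g : ℝ → ℝ} (hf : Monotone f) (hg : Monotone g) {n C : ℝ}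
    (hn : 0 < n) (h : ∀ s, 0 ≤ s → f s = n * g (n * s) - C) {s : ℝ} (hs : 0 ≤ s) :
    Function.rightLim f s = n * Function.rightLim g (n * s) - C := by
  have hmul : Tendsto (fun x => n * x) (𝓝[>] s) (𝓝[>] (n * s)) :=
    tendsto_nhdsWithin_of_tendsto_nhds_of_eventually_within _
      ((continuous_const_mul n).continuousWithinAt.tendsto)
      (eventually_nhdsWithin_of_forall fun x hx => mul_lt_mul_of_pos_left hx hn)
  have h1 := (((hg.tendsto_rightLim (n * s)).comp hmul).const_mul n).sub_const C
  refine tendsto_nhds_unique (hf.tendsto_rightLim s) (h1.congr' ?_)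
  filter_upwards [self_mem_nhdsWithin] with x hx
  exact (h x (hs.trans (le_of_lt hx))).symm

theorem stieltjes_measure_restrict_eq {f g : ℝ → ℝ} (hf : Monotone f) (hg : Monotone g) {n C : ℝ}
    (hn : 0 < n) (h : ∀ s, 0 ≤ s → f s = n * g (n * s) - C) :
    hf.stieltjesFunction.measure.restrict (Ioi 0) =
      ENNReal.ofReal n •
        (hg.stieltjesFunction.measure.map (fun t => n⁻¹ * t)).restrict (Ioi 0) := by
  refine Measure.ext_of_Ioc _ _ fun a b _ => ?_
  rw [Measure.smul_apply, Measure.restrict_apply measurableSet_Ioc,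
    Measure.restrict_apply measurableSet_Ioc, Ioc_inter_Ioi,
    Measure.map_apply (measurable_const_mul _) measurableSet_Ioc]
  have ha : 0 ≤ max a 0 := le_max_right _ _
  generalize max a 0 = a at ha
  have hpre : (fun t => n⁻¹ * t) ⁻¹' Ioc a b = Ioc (n * a) (n * b) := by
    ext t
    simp only [mem_preimage, mem_Ioc, lt_inv_mul_iff₀ hn, inv_mul_le_iff₀ hn]
  rw [hpre, StieltjesFunction.measure_Ioc, StieltjesFunction.measure_Ioc, smul_eq_mul,
    ← ENNReal.ofReal_mul hn.le]
  -- If `b ≤ a` the interval is empty; `b` may then be negative, where the affine relation is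
  -- unavailable.
  rcases le_or_gt b a with hab | hab
  · rw [ENNReal.ofReal_of_nonpos, ENNReal.ofReal_of_nonpos]
    · refine mul_nonpos_of_nonneg_of_nonpos hn.le (sub_nonpos.2 ?_)
      exact (hg.stieltjesFunction).mono (mul_le_mul_of_nonneg_left hab hn.le)
    · exact sub_nonpos.2 (hf.stieltjesFunction.mono hab)
  · simp only [Monotone.stieltjesFunction_eq]
    rw [rightLim_eq_of_eq_affine hf hg hn h ha,
      rightLim_eq_of_eq_affine hf hg hn h (ha.trans hab.le)]
    congr 1
    ring

theorem lintegral_neg_log_lt_top_of_eq_affine {f g : ℝ → ℝ} (hf : Monotone f) (hg : Monotone g)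
    {n C : ℝ} (hn : 1 ≤ n) (h : ∀ s, 0 ≤ s → f s = n * g (n * s) - C)
    (hfin : ∫⁻ t in Ioc (0 : ℝ) 1, ENNReal.ofReal (-Real.log t) ∂hg.stieltjesFunction.measure < ∞) :
    ∫⁻ t in Ioc (0 : ℝ) 1, ENNReal.ofReal (-Real.log t) ∂hf.stieltjesFunction.measure < ∞ := by
  have hn0 : 0 < n := zero_lt_one.trans_le hn
  have hmeas : Measurable fun t : ℝ => ENNReal.ofReal (-Real.log t) :=
    Real.measurable_log.neg.ennreal_ofReal
  set μ := hg.stieltjesFunction.measure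
  have hsub : Ioc (0 : ℝ) 1 ∩ Ioi 0 = Ioc 0 1 := inter_eq_left.2 fun t ht => ht.1
  have hpre : (fun t => n⁻¹ * t) ⁻¹' Ioc (0 : ℝ) 1 = Ioc 0 n := by
    ext t
    simp only [mem_preimage, mem_Ioc, lt_inv_mul_iff₀ hn0, inv_mul_le_iff₀ hn0, mul_zero, mul_one]
  rw [← hsub, ← Measure.restrict_restrict measurableSet_Ioc,
    stieltjes_measure_restrict_eq hf hg hn0 h, Measure.restrict_smul,
    Measure.restrict_restrict measurableSet_Ioc, hsub, lintegral_smul_measure,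
    Measure.restrict_map (measurable_const_mul _) measurableSet_Ioc,
    lintegral_map hmeas (measurable_const_mul _), hpre]
  refine ENNReal.mul_lt_top ENNReal.ofReal_lt_top ?_
  -- `-log (t / n) = log n - log t`, and the last term is nonpositive for `t ≥ 1`, so truncation by
  -- `ENNReal.ofReal` removes it.
  have hbound : ∀ t ∈ Ioc 0 n, ENNReal.ofReal (-Real.log (n⁻¹ * t)) ≤
      ENNReal.ofReal (Real.log n) +
        (Ioc (0 : ℝ) 1).indicator (fun t => ENNReal.ofReal (-Real.log t)) t := by
    rintro t ⟨ht0, -⟩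
    rw [Real.log_mul (inv_ne_zero hn0.ne') ht0.ne', Real.log_inv, neg_add, neg_neg]
    refine ENNReal.ofReal_add_le.trans (add_le_add le_rfl ?_)
    by_cases ht : t ≤ 1
    · rw [indicator_of_mem (show t ∈ Ioc (0 : ℝ) 1 from ⟨ht0, ht⟩)]
    · rw [ENNReal.ofReal_of_nonpos (neg_nonpos.2 (Real.log_nonneg (le_of_not_ge ht)))]
      exact zero_le
  refine (setLIntegral_mono' measurableSet_Ioc hbound).trans_lt ?_
  rw [lintegral_add_left measurable_const, setLIntegral_const]
  refine ENNReal.add_lt_top.2 ⟨ENNReal.mul_lt_top ENNReal.ofReal_lt_top ?_, ?_⟩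
  · rw [StieltjesFunction.measure_Ioc]
    exact ENNReal.ofReal_lt_top
  · refine (setLIntegral_le_lintegral _ _).trans_lt ?_
    rwa [lintegral_indicator measurableSet_Ioc]

end Stieltjes

/-! ### Traces, spectral densities and matrices along the extension. -/

section Extension

variable {F π Q : Type*} [Group F] [Group π] [Group Q] [Finite F] (S : GroupExtension F π Q) {d : ℕ}

theorem trace_conjIsometry_pullbackPow (T : ell2Pow Q d →L[ℂ] ell2Pow Q d) :
    trace (conjIsometry (pullbackPow S d) T) = (Nat.card F : ℂ)⁻¹ * trace T := by
  have hn : (0 : ℝ) ≤ Nat.card F := Nat.cast_nonneg _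
  have hc : ((√(Nat.card F) : ℝ) : ℂ)⁻¹ * ((√(Nat.card F) : ℝ) : ℂ)⁻¹ = (Nat.card F : ℂ)⁻¹ := by
    rw [← mul_inv, ← Complex.ofReal_mul, Real.mul_self_sqrt hn, Complex.ofReal_natCast]
  rw [trace, trace, Finset.mul_sum]
  refine Finset.sum_congr rfl fun i _ => ?_
  rw [conjIsometry_apply]
  refine (ContinuousLinearMap.adjoint_inner_left (pullbackPow S d).toContinuousLinearMap
    _ _).symm.trans ?_
  rw [adjoint_pullbackPow_unitVec, map_smul, inner_smul_left, inner_smul_right, ← mul_assoc, ← hc]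
  simp

theorem spectralDensity_conjIsometry {T : ell2Pow Q d →L[ℂ] ell2Pow Q d} (hT : IsSelfAdjoint T)
    {t : ℝ} (ht : 0 ≤ t) :
    spectralDensity (conjIsometry (pullbackPow S d) T) t =
      (trace (1 - conjIsometry (pullbackPow S d) 1)).re +
        (Nat.card F : ℝ)⁻¹ * spectralDensity T t := by
  have hadd (A B : ell2Pow π d →L[ℂ] ell2Pow π d) : trace (A + B) = trace A + trace B := by
    simp [trace, Finset.sum_add_distrib]
  rw [spectralDensity, spectralProjection_conjIsometry _ hT ht, hadd,
    trace_conjIsometry_pullbackPow, Complex.add_re, ← Complex.ofReal_natCast, ← Complex.ofReal_inv,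
    Complex.re_ofReal_mul, spectralDensity]

/-- The lift `L` need not be additive or multiplicative: after the norm element it acts only on
pullbacks, where just its image in `ℤQ` matters. -/
theorem exists_matrixOp_eq_conjIsometry (A : Matrix (Fin d) (Fin d) (MonoidAlgebra ℤ Q)) :
    ∃ B : Matrix (Fin d) (Fin d) (MonoidAlgebra ℤ π),
      matrixOp B = conjIsometry (pullbackPow S d) ((Nat.card F : ℂ) • matrixOp A) := by
  have hsurj : Function.Surjective
      (MonoidAlgebra.mapDomain S.rightHom : MonoidAlgebra ℤ π → MonoidAlgebra ℤ Q) := by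
    intro x
    induction x using MonoidAlgebra.induction_linear with
    | zero => exact ⟨0, MonoidAlgebra.mapDomain_zero _⟩
    | add x y hx hy =>
      obtain ⟨a, rfl⟩ := hx
      obtain ⟨b, rfl⟩ := hy
      exact ⟨a + b, MonoidAlgebra.mapDomain_add ..⟩
    | single q r =>
      obtain ⟨g, rfl⟩ := S.rightHom_surjective q
      exact ⟨MonoidAlgebra.single g r, MonoidAlgebra.mapDomain_single⟩
  choose L hL using hsurj
  refine ⟨Matrix.of fun i j => L (A i j) * normElement F S, ?_⟩
  ext1 v
  ext1 i
  rw [matrixOp_apply, conjIsometry_apply, pullbackPow_apply, _root_.smul_apply, PiLp.smul_apply,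
    matrixOp_apply, map_smul, map_sum, Finset.smul_sum]
  refine Finset.sum_congr rfl fun j _ => ?_
  rw [Matrix.of_apply, map_mul, mul_apply_eq_comp, ringAction_normElement_eq_smul, map_smul,
    ringAction_pullback, hL, adjoint_pullbackPow_apply]

end Extension

end L2Det

end

theorem mainTheorem10 {F π Q : Type*} [Group F] [Group π] [Group Q] [Finite F]
    (S : GroupExtension F π Q) (hπ : L2Det.IsDetClass π) : L2Det.IsDetClass Q := by
  intro d A hA
  obtain ⟨B, hB⟩ := L2Det.exists_matrixOp_eq_conjIsometry S A
  have hn : (1 : ℝ) ≤ Nat.card F := by exact_mod_cast Nat.card_pos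
  have hn0 : (0 : ℝ) < Nat.card F := zero_lt_one.trans_le hn
  have hpos : ((Nat.card F : ℂ) • L2Det.matrixOp A).IsPositive :=
    open scoped ComplexOrder in hA.smul_of_nonneg (Nat.cast_nonneg _)
  have hBpos : (L2Det.matrixOp B).IsPositive := hB ▸ hpos.conj_adjoint _
  refine L2Det.lintegral_neg_log_lt_top_of_eq_affine (L2Det.spectralDensity_mono _)
    (L2Det.spectralDensity_mono (L2Det.matrixOp B)) hn
    (C := Nat.card F * (L2Det.trace (1 - L2Det.conjIsometry (L2Det.pullbackPow S d) 1)).re)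
    (fun s hs => ?_) (hπ d B hBpos)
  -- `C` cancels the contribution of `1 - U U*`, leaving the density of `|F| A` at `|F| s`, which is
  -- that of `A` at `s`.
  rw [hB, L2Det.spectralDensity_conjIsometry S hpos.isSelfAdjoint (by positivity), mul_add,
    mul_inv_cancel_left₀ hn0.ne', add_sub_cancel_left]
  rw [L2Det.spectralDensity, L2Det.spectralDensity,
    ← L2Det.spectralProjection_smul hA.isSelfAdjoint hn0, Complex.ofReal_natCast]
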